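/- Let $N\ge 2$. Work in the $2^N$-dimensional Hilbert space of $N$ qubits. A symmetric $N$-qubit state is a density matrix $\rho$ with $P_\sigma\rho P_\tau=\rho$ for all permutation operators $P_\sigma,P_\tau$ of the $N$ qubits; it is supported on the $(N+1)$-dimensional symmetric subspace, and its spectrum means the $N+1$ eigenvalues (with multiplicity) of $\rho$ on that subspace. A state is PPT if for every bipartition $A|B$ of the qubits into two non-empty sets its partial transpose $\rho^{T_A}$ (in the computational basis) is positive semidefinite. A symmetric state $\rho$ is symmetric absolutely PPT (SAPPT) if $U\rho U^\dagger$ is PPT for every $U\in\mathrm{SU}(N+1)$ acting on the symmetric subspace. Let $p\in[0,1]$, and let $\rho$ be any symmetric $N$-qubit state with spectrum $$\left(1-\frac{Np}{N+1},\ \frac{p}{N+1},\ \dots,\ \frac{p}{N+1}\right),$$ where $\frac{p}{N+1}$ occurs $N$ times. Then $\rho$ is SAPPT if and only if $p\in[p_{\min},1]$, where $$p_{\min}=\frac{1}{1+2\left[(N+1)\binom{N}{\lfloor N/2\rfloor}\right]^{-1}}.$$ -/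

import Mathlib

open scoped Matrix ComplexOrder

noncomputable section

/-- Operators on the Hilbert space of `N` qubits, as matrices in the computational basis, whose
elements are labelled by the bit strings `Fin N → Fin 2`. -/
abbrev QubitOp (N : ℕ) : Type := Matrix (Fin N → Fin 2) (Fin N → Fin 2) ℂ

/-- The permutation operator `P_σ` that permutes the `N` qubits according to `σ`. -/
def qubitPerm {N : ℕ} (σ : Equiv.Perm (Fin N)) : QubitOp N :=
  Equiv.Perm.permMatrix ℂ (σ.arrowCongr (Equiv.refl (Fin 2)))

/-- Symmetric `N`-qubit states: density matrices `ρ` with `P_σ ρ P_τ = ρ` for all permutations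
`σ`, `τ` of the qubits. -/
structure IsSymmetricState {N : ℕ} (ρ : QubitOp N) : Prop where
  posSemidef : ρ.PosSemidef
  trace_eq_one : ρ.trace = 1
  perm_invariant : ∀ σ τ : Equiv.Perm (Fin N), qubitPerm σ * ρ * qubitPerm τ = ρ

/-- The number of qubits in state `1` in a bit string. -/
def bitWeight {N : ℕ} (x : Fin N → Fin 2) : ℕ := ∑ i, (x i : ℕ)

/-- The matrix whose columns are the Dicke states `D_N^(α)`, `α = 0, …, N`: the normalized
uniform superposition of all bit strings with exactly `α` ones. These columns are the standard
orthonormal basis of the symmetric subspace of the `N`-qubit space. -/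
def dickeMatrix (N : ℕ) : Matrix (Fin N → Fin 2) (Fin (N + 1)) ℂ :=
  Matrix.of fun x α =>
    if bitWeight x = (α : ℕ) then (((Real.sqrt (N.choose (α : ℕ)))⁻¹ : ℝ) : ℂ) else 0

/-- The compression of an operator to the `(N+1)`-dimensional symmetric subspace, as a matrix in
the Dicke basis. -/
def symCompress {N : ℕ} (ρ : QubitOp N) : Matrix (Fin (N + 1)) (Fin (N + 1)) ℂ :=
  (dickeMatrix N)ᴴ * ρ * dickeMatrix N

/-- The spectrum of a symmetric state: the `N + 1` eigenvalues, with multiplicity, of the state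
as an operator on the symmetric subspace. -/
def symSpectrum {N : ℕ} (ρ : QubitOp N) : Multiset ℂ := (symCompress ρ).charpoly.roots

/-- The operator on the `N`-qubit space that acts as `U` (given in the Dicke basis) on the
symmetric subspace and vanishes on its orthogonal complement. -/
def symLift {N : ℕ} (U : Matrix (Fin (N + 1)) (Fin (N + 1)) ℂ) : QubitOp N :=
  dickeMatrix N * U * (dickeMatrix N)ᴴ

/-- The partial transpose `ρ^{T_A}` with respect to the set `A` of qubits, in the computational
basis: row and column labels are exchanged on the qubits in `A`. -/
def partialTranspose {N : ℕ} (A : Finset (Fin N)) (ρ : QubitOp N) : QubitOp N :=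
  Matrix.of fun x y => ρ (A.piecewise y x) (A.piecewise x y)

/-- `ρ` has positive partial transpose across every bipartition `A | Aᶜ` of the qubits into two
non-empty parts. -/
def IsPPT {N : ℕ} (ρ : QubitOp N) : Prop :=
  ∀ A : Finset (Fin N), A.Nonempty → Aᶜ.Nonempty → (partialTranspose A ρ).PosSemidef

/-- `ρ` is symmetric absolutely PPT: `U ρ U†` is PPT for every `U ∈ SU(N+1)` acting on the
symmetric subspace. -/
def IsSAPPT {N : ℕ} (ρ : QubitOp N) : Prop :=
  ∀ U ∈ Matrix.specialUnitaryGroup (Fin (N + 1)) ℂ, IsPPT (symLift U * ρ * (symLift U)ᴴ)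

/-- The threshold `p_min = 1 / (1 + 2 [(N+1) C(N, ⌊N/2⌋)]⁻¹)`. -/
def pMin (N : ℕ) : ℝ := 1 / (1 + 2 * (((N : ℝ) + 1) * (N.choose (N / 2) : ℝ))⁻¹)

end

/-! On the symmetric subspace a state with this spectrum is `p/(N+1) • 1 + (1 - p) • |e⟩⟨e|`, and
SU(N+1) carries `e` to every unit vector up to phase. So SAPPT asks that `p/(N+1) • P^{T_A} + (1 -
p) • |ψ⟩⟨ψ|^{T_A}` be positive for all symmetric unit `ψ` and all `A`, with `P` the symmetric
projector. Let `|A| = k`. Only the component of the test vector in Sym(A) ⊗ Sym(Aᶜ) matters. There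
`P^{T_A}` is at least `1 / C(N, k)` (`sum_factorial_mul_norm_sq_le`), and a pure state's partial
transpose is at least `-1/2` (`neg_half_le_re_sum`). Hence `(1 - p)/2 ≤ p/(N+1)/C(N, k)` suffices
(`partialTranspose_posSemidef_of_le`). The GHZ state shows that it is necessary, since both bounds
are attained on one vector (`half_le_of_partialTranspose_posSemidef`). The strictest case is `k =
⌊N/2⌋`, and solving for `p` gives `pMin`. -/

/-! ### Partial transpose of a pure state. -/

/-- An antisymmetric matrix has operator norm at most its Frobenius norm divided by `√2`. -/
theorem antisymm_two_mul_sum_norm_sq_le {ι : Type*} [Fintype ι] (Z : ι → ι → ℂ)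
    (hZ : ∀ x y, Z x y = -Z y x) (u : ι → ℂ) :
    2 * ∑ x, ‖∑ y, Z x y * u y‖ ^ 2 ≤ (∑ x, ∑ y, ‖Z x y‖ ^ 2) * ∑ y, ‖u y‖ ^ 2 := by
  set w : ι → ℂ := fun x => ∑ y, Z x y * u y with hw
  set n := ∑ x, ‖w x‖ ^ 2 with hn
  -- Antisymmetry of `Z` allows `w̄ ⊗ u` to be antisymmetrized before Cauchy–Schwarz; this gains the
  -- factor 2.
  have key : (2 * n : ℂ) = ∑ x, ∑ y, Z x y * (star (w x) * u y - star (w y) * u x) := by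
    have h1 : ∑ x, ∑ y, Z x y * (star (w x) * u y) = (n : ℂ) := by
      rw [hn]
      push_cast
      refine Finset.sum_congr rfl fun x _ => ?_
      rw [← Complex.conj_mul', hw, Finset.mul_sum]
      exact Finset.sum_congr rfl fun y _ => by simp only [starRingEnd_apply]; ring
    have h2 : ∑ x, ∑ y, Z x y * (star (w y) * u x) = -(n : ℂ) := by
      rw [Finset.sum_comm, ← h1, ← Finset.sum_neg_distrib]
      refine Finset.sum_congr rfl fun x _ => ?_
      rw [← Finset.sum_neg_distrib]
      exact Finset.sum_congr rfl fun y _ => by rw [hZ y x]; ring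
    simp only [mul_sub, Finset.sum_sub_distrib, h1, h2]
    ring
  have hle : 2 * n ≤ ∑ p : ι × ι, ‖Z p.1 p.2‖ * ‖star (w p.1) * u p.2 - star (w p.2) * u p.1‖ := by
    have : ‖(2 * n : ℂ)‖ = 2 * n := by
      rw [norm_mul, Complex.norm_real, Real.norm_of_nonneg (by positivity)]
      simp
    rw [← this, key, ← Fintype.sum_prod_type']
    refine (norm_sum_le _ _).trans (le_of_eq ?_)
    simp
  -- Lagrange's identity: the left side equals `2‖w‖²‖u‖² - 2|S|²`.
  have hsq : ∑ p : ι × ι, ‖star (w p.1) * u p.2 - star (w p.2) * u p.1‖ ^ 2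
      ≤ 2 * n * ∑ y, ‖u y‖ ^ 2 := by
    set S : ℂ := ∑ x, w x * u x with hS
    have hc : ((∑ p : ι × ι, ‖star (w p.1) * u p.2 - star (w p.2) * u p.1‖ ^ 2 : ℝ) : ℂ)
        = ((2 * n * ∑ y, ‖u y‖ ^ 2 - 2 * ‖S‖ ^ 2 : ℝ) : ℂ) := by
      rw [Fintype.sum_prod_type, hn]
      push_cast
      have hd : ∀ x y, ((‖star (w x) * u y - star (w y) * u x‖ : ℝ) : ℂ) ^ 2
          = ((‖w x‖ : ℝ) : ℂ) ^ 2 * ((‖u y‖ : ℝ) : ℂ) ^ 2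
            + ((‖w y‖ : ℝ) : ℂ) ^ 2 * ((‖u x‖ : ℝ) : ℂ) ^ 2
            - w x * u x * star (w y * u y) - star (w x * u x) * (w y * u y) := by
        intro x y
        simp only [← Complex.conj_mul', starRingEnd_apply, star_sub, star_mul', star_star]
        ring
      have hS' : ((‖S‖ : ℝ) : ℂ) ^ 2 = (∑ x, w x * u x) * ∑ x, star (w x * u x) := by
        rw [← Complex.conj_mul', hS, starRingEnd_apply, star_sum, mul_comm]
      simp only [hd, hS', Finset.sum_add_distrib, Finset.sum_sub_distrib, ← Finset.mul_sum,
        ← Finset.sum_mul]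
      ring
    have := Complex.ofReal_injective hc
    nlinarith [sq_nonneg ‖S‖]
  have hcs := Finset.sum_mul_sq_le_sq_mul_sq Finset.univ (fun p : ι × ι => ‖Z p.1 p.2‖)
    (fun p => ‖star (w p.1) * u p.2 - star (w p.2) * u p.1‖)
  have hZ' : ∑ x, ∑ y, ‖Z x y‖ ^ 2 = ∑ p : ι × ι, ‖Z p.1 p.2‖ ^ 2 := by
    rw [Fintype.sum_prod_type]
  rw [hZ']
  set A := ∑ p : ι × ι, ‖Z p.1 p.2‖ ^ 2
  set B := ∑ y, ‖u y‖ ^ 2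
  have hA : 0 ≤ A := by positivity
  have hB : 0 ≤ B := by positivity
  have hn0 : 0 ≤ n := by positivity
  have h4 : (2 * n) ^ 2 ≤ A * (2 * n * B) :=
    (pow_le_pow_left₀ (by positivity) hle 2).trans (hcs.trans (by gcongr))
  rcases hn0.eq_or_lt with h | h
  · rw [← h]; simp; positivity
  · nlinarith

/-- The partial transpose of a pure state `Ψ` is bounded below by `-‖Ψ‖² / 2`. -/
theorem neg_half_le_re_sum {α β : Type*} [Fintype α] [Fintype β] (Ψ V : α → β → ℂ) :
    -(1 / 2) * (∑ a, ∑ b, ‖Ψ a b‖ ^ 2) * (∑ a, ∑ b, ‖V a b‖ ^ 2) ≤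
      (∑ a, ∑ b, ∑ a', ∑ b', star (V a b) * V a' b' * (Ψ a' b * star (Ψ a b'))).re := by
  set W : β → β → ℂ := fun x y => ∑ a, Ψ a x * V a y with hW
  set Z : β → β → ℂ := fun x y => W x y - W y x with hZ
  set n := ∑ x, ∑ y, ‖Z x y‖ ^ 2 with hn
  have h1 : ∑ a, ∑ b, ∑ a', ∑ b', star (V a b) * V a' b' * (Ψ a' b * star (Ψ a b'))
      = ∑ x, ∑ y, W x y * star (W y x) := by
    simp only [hW, star_sum, Finset.sum_mul_sum]
    rw [Finset.sum_comm]
    refine Finset.sum_congr rfl fun x _ => ?_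
    have : ∀ a, ∑ a', ∑ b', star (V a x) * V a' b' * (Ψ a' x * star (Ψ a b'))
      = ∑ b', ∑ a', star (V a x) * V a' b' * (Ψ a' x * star (Ψ a b')) := fun a => Finset.sum_comm
    simp only [this]
    rw [Finset.sum_comm]
    refine Finset.sum_congr rfl fun y _ => ?_
    rw [Finset.sum_comm]
    refine Finset.sum_congr rfl fun a _ => Finset.sum_congr rfl fun a' _ => ?_
    rw [star_mul']; ring
  -- The form is the squared norm of the symmetric part of `W` minus that of its antisymmetric part
  -- `Z / 2`.
  have h2 : -(n / 4) ≤ (∑ x, ∑ y, W x y * star (W y x)).re := by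
    have e : ∀ x y, ‖Z x y‖ ^ 2 + 4 * (W x y * star (W y x)).re = ‖W x y + W y x‖ ^ 2 := by
      intro x y
      simp only [hZ, ← Complex.normSq_eq_norm_sq, Complex.normSq_apply]
      simp
      ring
    have : 0 ≤ n + 4 * (∑ x, ∑ y, W x y * star (W y x)).re := by
      simp only [hn, Complex.re_sum, Finset.mul_sum, ← Finset.sum_add_distrib, e]
      positivity
    linarith
  -- `Z` pairs only with the antisymmetric part of `W`, so `‖Z‖² = 2⟨Z, W⟩`; expanding `W` isolates
  -- `V` for Cauchy–Schwarz.
  have h3 : (n : ℂ) = 2 * ∑ p : α × β, V p.1 p.2 * ∑ x, star (Z x p.2) * Ψ p.1 x := by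
    have e1 : ∑ x, ∑ y, star (Z x y) * W x y = ∑ p : α × β, V p.1 p.2 * ∑ x, star (Z x p.2) * Ψ p.1 x := by
      rw [Fintype.sum_prod_type]
      simp only [hW, Finset.mul_sum]
      rw [Finset.sum_comm' (t' := Finset.univ) (s' := fun _ => Finset.univ) (by simp)]
      rw [Finset.sum_comm (s := (Finset.univ : Finset α))]
      refine Finset.sum_congr rfl fun y _ => ?_
      rw [Finset.sum_comm]
      exact Finset.sum_congr rfl fun a _ => Finset.sum_congr rfl fun x _ => by ring
    have e2 : ∑ x, ∑ y, star (Z x y) * W y x = - ∑ x, ∑ y, star (Z x y) * W x y := by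
      rw [Finset.sum_comm, ← Finset.sum_neg_distrib]
      refine Finset.sum_congr rfl fun x _ => ?_
      rw [← Finset.sum_neg_distrib]
      refine Finset.sum_congr rfl fun y _ => ?_
      simp only [hZ, star_sub]; ring
    rw [← e1, hn]
    push_cast
    simp only [← Complex.conj_mul', starRingEnd_apply]
    conv_lhs => enter [2, x, 2, y]; rw [show star (Z x y) * Z x y = star (Z x y) * W x y - star (Z x y) * W y x by simp only [hZ]; ring]
    simp only [Finset.sum_sub_distrib, e2]
    ring
  set A := ∑ a, ∑ b, ‖Ψ a b‖ ^ 2 with hA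
  set B := ∑ a, ∑ b, ‖V a b‖ ^ 2 with hB
  have hn0 : 0 ≤ n := by positivity
  have hA0 : 0 ≤ A := by positivity
  have hB0 : 0 ≤ B := by positivity
  have h4 : 2 * ∑ p : α × β, ‖∑ x, star (Z x p.2) * Ψ p.1 x‖ ^ 2 ≤ n * A := by
    rw [Fintype.sum_prod_type, Finset.mul_sum, hA, Finset.mul_sum]
    refine Finset.sum_le_sum fun a _ => ?_
    refine (antisymm_two_mul_sum_norm_sq_le (fun y x => star (Z x y))
      (fun x y => by simp [hZ]) (Ψ a)).trans (le_of_eq ?_)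
    rw [Finset.sum_comm, hn]
    simp
  have h5 : n ≤ 2 * ∑ p : α × β, ‖V p.1 p.2‖ * ‖∑ x, star (Z x p.2) * Ψ p.1 x‖ := by
    have : ‖(n : ℂ)‖ = n := by rw [Complex.norm_real, Real.norm_of_nonneg hn0]
    rw [← this, h3, norm_mul]
    simp only [Complex.norm_ofNat]
    gcongr
    refine (norm_sum_le _ _).trans (le_of_eq ?_)
    simp
  have hcs := Finset.sum_mul_sq_le_sq_mul_sq Finset.univ (fun p : α × β => ‖V p.1 p.2‖)
    (fun p => ‖∑ x, star (Z x p.2) * Ψ p.1 x‖)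
  have hB' : B = ∑ p : α × β, ‖V p.1 p.2‖ ^ 2 := by rw [hB, Fintype.sum_prod_type]
  rw [← hB'] at hcs
  have h6 : n ^ 2 ≤ 2 * B * (n * A) := by
    have := pow_le_pow_left₀ hn0 h5 2
    nlinarith
  have h7 : n ≤ 2 * B * A := by
    rcases hn0.eq_or_lt with h | h
    · rw [← h]; positivity
    · nlinarith
  rw [h1]
  nlinarith

/-! ### Lower bound for the partially transposed symmetric projector. -/

open Nat in
/-- The coefficients that factor the kernel `(a' + b)!`. -/
noncomputable def ladderCoeff (i j a b : ℕ) : ℝ :=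
  if i ≤ a ∧ a + j = b + i then (a ! * b ! : ℝ) / (a - i)! else 0

theorem ladderCoeff_swap (i j a b : ℕ) : ladderCoeff i j a b = ladderCoeff j i b a := by
  unfold ladderCoeff
  by_cases h : i ≤ a ∧ a + j = b + i
  · have h' : j ≤ b ∧ b + i = a + j := by omega
    rw [if_pos h, if_pos h', show a - i = b - j by omega, mul_comm]
  · have h' : ¬ (j ≤ b ∧ b + i = a + j) := by omega
    rw [if_neg h, if_neg h']

theorem ladderCoeff_eq_zero_of_lt {i j a b : ℕ} (h : a < i) : ladderCoeff i j a b = 0 := by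
  rw [ladderCoeff, if_neg (by omega)]

open Nat in
theorem ladderCoeff_self (a b : ℕ) : ladderCoeff a b a b = a ! * b ! := by
  simp [ladderCoeff, add_comm]

-- For a standard complex Gaussian `z`, `(a' + b)!` is the inner product of the monomials `z^a z̄^b`
-- and `z^a' z̄^b'`. The `ladderCoeff i j` are their pairings with the complex Hermite polynomials,
-- orthogonal with squared norms `i! j!`, so the sum is Parseval's identity. Algebraically, only `j
-- = i + d` survives and Vandermonde's convolution sums the rest.
open Nat in
theorem sum_ladderCoeff_mul_aux (m n a a' d : ℕ) (ha : a ≤ m) (hd : a + d ≤ n) :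
    ∑ i ∈ Finset.range (m + 1), ∑ j ∈ Finset.range (n + 1),
      ((i ! : ℝ) * j !)⁻¹ * (ladderCoeff i j a (a + d) * ladderCoeff i j a' (a' + d))
      = ((a' + (a + d))! : ℝ) := by
  have h1 : ∀ i ∈ Finset.range (m + 1), ∑ j ∈ Finset.range (n + 1),
      ((i ! : ℝ) * j !)⁻¹ * (ladderCoeff i j a (a + d) * ladderCoeff i j a' (a' + d))
      = if i ≤ a then (a ! * (a' + d)! : ℝ) * (a'.choose i * (a + d).choose (a - i)) else 0 := by
    intro i hi
    split_ifs with h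
    · rw [Finset.sum_eq_single (i + d)]
      · rw [ladderCoeff, if_pos (by omega), ladderCoeff]
        split_ifs with h'
        · rw [Nat.cast_choose ℝ h'.1, Nat.cast_choose ℝ (show a - i ≤ a + d by omega),
            show a + d - (a - i) = i + d by omega]
          have := fun n : ℕ => (Nat.cast_ne_zero (R := ℝ)).2 (Nat.factorial_ne_zero n)
          field_simp [this]
        · rw [Nat.choose_eq_zero_of_lt (by omega)]; simp
      · intro j _ hj
        rw [ladderCoeff, if_neg (by omega)]; simp
      · intro hj
        simp at hj; omega
    · exact Finset.sum_eq_zero fun j _ => by rw [ladderCoeff_eq_zero_of_lt (by omega)]; simp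
  rw [Finset.sum_congr rfl h1, ← Finset.sum_filter,
    show (Finset.range (m + 1)).filter (· ≤ a) = Finset.range (a + 1) by
      ext; simp; omega, ← Finset.mul_sum]
  have h2 := Nat.add_choose_eq a' (a + d) a
  rw [Finset.Nat.sum_antidiagonal_eq_sum_range_succ
    (fun i j => a'.choose i * (a + d).choose j)] at h2
  have h3 : ((a' + (a + d)).choose a : ℝ)
      = ∑ i ∈ Finset.range (a + 1), (a'.choose i * (a + d).choose (a - i) : ℝ) := by
    exact_mod_cast h2
  rw [← h3, Nat.cast_choose ℝ (show a ≤ a' + (a + d) by omega),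
    show a' + (a + d) - a = a' + d by omega]
  have := fun n : ℕ => (Nat.cast_ne_zero (R := ℝ)).2 (Nat.factorial_ne_zero n)
  field_simp [this]

open Nat in
theorem sum_ladderCoeff_mul (m n a b a' b' : ℕ) (ha : a ≤ m) (hb : b ≤ n) :
    ∑ i ∈ Finset.range (m + 1), ∑ j ∈ Finset.range (n + 1),
      ((i ! : ℝ) * j !)⁻¹ * (ladderCoeff i j a b * ladderCoeff i j a' b')
      = if a' + b = a + b' then ((a' + b)! : ℝ) else 0 := by
  split_ifs with h
  · rcases le_total a b with hab | hab
    · obtain ⟨d, rfl⟩ := Nat.exists_eq_add_of_le hab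
      obtain rfl : b' = a' + d := by omega
      exact sum_ladderCoeff_mul_aux m n a a' d ha hb
    · obtain ⟨d, rfl⟩ := Nat.exists_eq_add_of_le hab
      obtain rfl : a' = b' + d := by omega
      rw [Finset.sum_comm, show b' + d + b = b' + (b + d) by ring,
        ← sum_ladderCoeff_mul_aux n m b b' d hb ha]
      refine Finset.sum_congr rfl fun j _ => Finset.sum_congr rfl fun i _ => ?_
      rw [ladderCoeff_swap i j, ladderCoeff_swap i j, mul_comm (i ! : ℝ)]
  · refine Finset.sum_eq_zero fun i _ => Finset.sum_eq_zero fun j _ => ?_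
    rw [_root_.mul_eq_zero]; right
    unfold ladderCoeff
    split_ifs <;> first | omega | simp

open Nat in
/-- The symmetric projector's partially transposed kernel dominates its diagonal part. -/
theorem sum_factorial_mul_norm_sq_le {k l : ℕ} (V : Fin (k + 1) × Fin (l + 1) → ℂ) :
    ∑ p : Fin (k + 1) × Fin (l + 1),
        ((p.1 : ℕ)! * (p.2 : ℕ)! * ((k - p.1)! * (l - p.2)!) : ℝ) * ‖V p‖ ^ 2 ≤
      (∑ p : Fin (k + 1) × Fin (l + 1), ∑ q : Fin (k + 1) × Fin (l + 1), star (V p) * V q *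
        ((if (q.1 + p.2 : ℕ) = p.1 + q.2 then
          ((q.1 + p.2 : ℕ)! * (k + l - (q.1 + p.2 : ℕ))! : ℝ) else 0 : ℝ) : ℂ)).re := by
  set c : Fin (k + 1) × Fin (l + 1) → ℝ := fun r => ((r.1 : ℕ)! * (r.2 : ℕ)! : ℝ)⁻¹ with hc
  set H : Fin (k + 1) × Fin (l + 1) → Fin (k + 1) × Fin (l + 1) → Fin (k + 1) × Fin (l + 1) → ℝ :=
    fun r s p => ladderCoeff r.1 r.2 p.1 p.2 * ladderCoeff s.1 s.2 (k - p.1) (l - p.2) with hH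
  have hsum : ∀ a b a' b' : ℕ, a ≤ k → b ≤ l →
      ∑ r : Fin (k + 1) × Fin (l + 1), c r * (ladderCoeff r.1 r.2 a b * ladderCoeff r.1 r.2 a' b')
        = if a' + b = a + b' then ((a' + b)! : ℝ) else 0 := by
    intro a b a' b' ha hb
    rw [← sum_ladderCoeff_mul k l a b a' b' ha hb, Fintype.sum_prod_type, Finset.sum_range]
    exact Finset.sum_congr rfl fun i _ => by rw [Finset.sum_range]
  -- The kernel is an entrywise product of two such Gram kernels, the second at the complementary
  -- weights `k - a`, `l - b`; the form is thus a sum of squares indexed by `(r, s)`.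
  have hker : ∀ p q : Fin (k + 1) × Fin (l + 1),
      (if (q.1 + p.2 : ℕ) = p.1 + q.2 then
          ((q.1 + p.2 : ℕ)! * (k + l - (q.1 + p.2 : ℕ))! : ℝ) else 0)
        = ∑ r, ∑ s, c r * c s * (H r s p * H r s q) := by
    rintro ⟨⟨a, ha⟩, ⟨b, hb⟩⟩ ⟨⟨a', ha'⟩, ⟨b', hb'⟩⟩
    have h1 := hsum a b a' b' (by omega) (by omega)
    have h2 := hsum (k - a) (l - b) (k - a') (l - b') (by omega) (by omega)
    have h3 : ∑ r, ∑ s, c r * c s * (H r s (⟨a, ha⟩, ⟨b, hb⟩) * H r s (⟨a', ha'⟩, ⟨b', hb'⟩))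
        = (if a' + b = a + b' then ((a' + b)! : ℝ) else 0) *
          (if (k - a') + (l - b) = (k - a) + (l - b') then (((k - a') + (l - b))! : ℝ) else 0) := by
      rw [← h1, ← h2, Finset.sum_mul_sum]
      refine Finset.sum_congr rfl fun r _ => Finset.sum_congr rfl fun s _ => ?_
      simp only [hH]; ring
    rw [h3]
    by_cases h : a' + b = a + b'
    · simp only [if_pos h]
      rw [if_pos (by omega), show k - a' + (l - b) = k + l - (a' + b) by omega]
    · simp only [if_neg h, zero_mul]
  have hc0 : ∀ r, 0 ≤ c r := fun r => by positivity
  have hrw : (∑ p : Fin (k + 1) × Fin (l + 1), ∑ q : Fin (k + 1) × Fin (l + 1), star (V p) * V q *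
        ((if (q.1 + p.2 : ℕ) = p.1 + q.2 then
          ((q.1 + p.2 : ℕ)! * (k + l - (q.1 + p.2 : ℕ))! : ℝ) else 0 : ℝ) : ℂ))
      = ((∑ r, ∑ s, c r * c s * ‖∑ p, H r s p * V p‖ ^ 2 : ℝ) : ℂ) := by
    push_cast
    simp only [← Complex.conj_mul', map_sum, map_mul, Complex.conj_ofReal]
    simp only [hker, Complex.ofReal_sum, Finset.mul_sum]
    have e1 : ∀ f : Fin (k + 1) × Fin (l + 1) → Fin (k + 1) × Fin (l + 1) →
        Fin (k + 1) × Fin (l + 1) → Fin (k + 1) × Fin (l + 1) → ℂ,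
        ∑ p, ∑ q, ∑ r, ∑ s, f p q r s = ∑ r, ∑ s, ∑ p, ∑ q, f p q r s := by
      intro f
      simp only [← Fintype.sum_prod_type' (f := fun _ _ => _)]
      have : ∀ g : (Fin (k + 1) × Fin (l + 1)) × (Fin (k + 1) × Fin (l + 1)) →
        (Fin (k + 1) × Fin (l + 1)) × (Fin (k + 1) × Fin (l + 1)) → ℂ,
        ∑ x, ∑ y, g x y = ∑ y, ∑ x, g x y := fun g => Finset.sum_comm
      have := this (fun x y => f x.1 x.2 y.1 y.2)
      simpa only [Fintype.sum_prod_type (α₁ := Fin (k + 1) × Fin (l + 1))] using this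
    rw [e1]
    refine Finset.sum_congr rfl fun r _ => Finset.sum_congr rfl fun s _ => ?_
    simp only [← Finset.mul_sum]
    rw [Finset.sum_mul_sum, Finset.mul_sum]
    simp only [Finset.mul_sum]
    refine Finset.sum_congr rfl fun p _ => Finset.sum_congr rfl fun q _ => ?_
    push_cast
    simp only [starRingEnd_apply]
    ring
  rw [hrw, Complex.ofReal_re]
  refine Finset.sum_le_sum fun r _ => ?_
  -- For each `r` keep only the square with `s = (k - r.1, l - r.2)`. The support conditions of the
  -- two factors force `p ≥ r` and `p ≤ r`, so this square involves `V r` alone.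
  refine le_trans (le_of_eq ?_) (Finset.single_le_sum (f := fun s => c r * c s * ‖∑ p, H r s p * V p‖ ^ 2)
    (fun s _ => by have := hc0 r; have := hc0 s; positivity)
    (Finset.mem_univ ((Fin.rev r.1, Fin.rev r.2) : Fin (k + 1) × Fin (l + 1))))
  obtain ⟨⟨a, ha⟩, ⟨b, hb⟩⟩ := r
  have hva : k + 1 - (a + 1) = k - a := by omega
  have hvb : l + 1 - (b + 1) = l - b := by omega
  simp only [hc, hH, Fin.val_rev, hva, hvb]
  rw [Finset.sum_eq_single (⟨a, ha⟩, ⟨b, hb⟩)]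
  · simp only [ladderCoeff_self, norm_mul, Complex.norm_real, mul_pow, Real.norm_eq_abs, sq_abs]
    have := fun n : ℕ => (Nat.cast_ne_zero (R := ℝ)).2 (Nat.factorial_ne_zero n)
    field_simp [this]
  · rintro ⟨⟨a', ha'⟩, ⟨b', hb'⟩⟩ _ hne
    have hne' : ¬ (a' = a ∧ b' = b) := by
      rintro ⟨rfl, rfl⟩; exact hne rfl
    simp only
    have : ladderCoeff a b a' b' * ladderCoeff (k - a) (l - b) (k - a') (l - b') = 0 := by
      unfold ladderCoeff
      split_ifs <;> first | (exfalso; omega) | simp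
    rw [this]; simp
  · simp

/-! ### Combining the two bounds in weight coordinates. -/

theorem sum_choose_mul_choose_mul (k l : ℕ) (g : ℕ → ℝ) :
    ∑ a : Fin (k + 1), ∑ b : Fin (l + 1), (k.choose a * l.choose b : ℝ) * g (a + b)
      = ∑ s ∈ Finset.range (k + l + 1), ((k + l).choose s : ℝ) * g s := by
  rw [← Finset.sum_range fun a => ∑ b : Fin (l + 1), (k.choose a * l.choose b : ℝ) * g (a + b)]
  have e : ∀ a, ∑ b : Fin (l + 1), (k.choose a * l.choose b : ℝ) * g (a + b)
      = ∑ b ∈ Finset.range (l + 1), (k.choose a * l.choose b : ℝ) * g (a + b) :=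
    fun a => (Finset.sum_range fun b => (k.choose a * l.choose b : ℝ) * g (a + b)).symm
  simp only [e]
  rw [← Finset.sum_product', ← Finset.sum_fiberwise_of_maps_to (g := fun p : ℕ × ℕ => p.1 + p.2)
    (t := Finset.range (k + l + 1)) (by
      rintro ⟨a, b⟩ h
      simp only [Finset.mem_product, Finset.mem_range] at h ⊢
      omega)]
  refine Finset.sum_congr rfl fun s _ => ?_
  have h : ((k + l).choose s : ℝ)
      = ∑ p ∈ Finset.HasAntidiagonal.antidiagonal s, (k.choose p.1 * l.choose p.2 : ℝ) := by
    exact_mod_cast Nat.add_choose_eq k l s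
  rw [h, Finset.sum_mul]
  refine (Finset.sum_congr rfl fun p hp => ?_).trans (Finset.sum_subset ?_ ?_)
  · rw [(Finset.mem_filter.1 hp).2]
  · intro p hp
    simpa using (Finset.mem_filter.1 hp).2
  · rintro ⟨a, b⟩ h1 h2
    rw [Finset.HasAntidiagonal.mem_antidiagonal] at h1
    simp only [Finset.mem_filter, Finset.mem_product,
      Finset.mem_range] at h1 h2
    by_cases ha : a ≤ k
    · rw [Nat.choose_eq_zero_of_lt (show l < b by omega)]; simp
    · rw [Nat.choose_eq_zero_of_lt (show k < a by omega)]; simp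

/-- The entries, in terms of weights, of the operator with matrix `lam • 1 + mu • f fᴴ` in the
Dicke basis. -/
noncomputable def dickeKernel (N : ℕ) (lam mu : ℝ) (f : ℕ → ℂ) (s t : ℕ) : ℂ :=
  ((if s = t then (lam : ℂ) else 0) + mu * (f s * star (f t))) *
    (((√(N.choose s))⁻¹ * (√(N.choose t))⁻¹ : ℝ) : ℂ)

-- The projector contributes at least `lam / C(k+l, k)` and the pure state at least `-mu / 2`, both
-- times the squared norm of the test vector.
open Nat in
theorem dickeKernel_quadForm_nonneg {k l : ℕ} {lam mu : ℝ} (hlam : 0 ≤ lam) (hmu : 0 ≤ mu)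
    (f : ℕ → ℂ) (hf : ∑ s ∈ Finset.range (k + l + 1), ‖f s‖ ^ 2 = 1)
    (hle : mu / 2 ≤ lam / (k + l).choose k) (V : Fin (k + 1) × Fin (l + 1) → ℂ) :
    0 ≤ (∑ p, ∑ q, star (V p) * V q *
      dickeKernel (k + l) lam mu f (q.1 + p.2) (p.1 + q.2)).re := by
  have hfac := fun n : ℕ => (Nat.cast_ne_zero (R := ℝ)).2 (Nat.factorial_ne_zero n)
  have hchoose : ∀ {n m : ℕ}, m ≤ n → 0 < (n.choose m : ℝ) := fun h => by
    exact_mod_cast Nat.choose_pos h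
  -- `V` holds sums over strings of fixed weights. Dividing by `r` gives coordinates in the
  -- orthonormal product Dicke basis; `Ψ` is the state `f` in that basis.
  set r : Fin (k + 1) → Fin (l + 1) → ℝ := fun a b => √(k.choose a) * √(l.choose b) with hr
  set Vh : Fin (k + 1) → Fin (l + 1) → ℂ := fun a b => V (a, b) / (r a b : ℝ) with hVh
  set Ψ : Fin (k + 1) → Fin (l + 1) → ℂ :=
    fun a b => f (a + b) * (r a b * (√((k + l).choose (a + b)))⁻¹ : ℝ) with hΨ
  set T := ∑ a, ∑ b, ‖Vh a b‖ ^ 2 with hT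
  have hr0 : ∀ a b, 0 < r a b := fun a b =>
    mul_pos (Real.sqrt_pos.2 (hchoose (by omega))) (Real.sqrt_pos.2 (hchoose (by omega)))
  have hr2 : ∀ a b, r a b ^ 2 = k.choose a * l.choose b := fun a b => by
    rw [hr, mul_pow, Real.sq_sqrt (by positivity), Real.sq_sqrt (by positivity)]
  have hΨ1 : ∑ a, ∑ b, ‖Ψ a b‖ ^ 2 = 1 := by
    have h : ∀ a b, ‖Ψ a b‖ ^ 2 = (k.choose a * l.choose b : ℝ) *
        (fun s => ‖f s‖ ^ 2 * ((k + l).choose s : ℝ)⁻¹) (a + b) := by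
      intro a b
      simp only [hΨ]
      rw [norm_mul, Complex.norm_real, mul_pow, Real.norm_eq_abs, sq_abs, mul_pow, hr2, inv_pow,
        Real.sq_sqrt (by positivity)]
      ring
    simp only [h]
    have h2 := sum_choose_mul_choose_mul k l (fun s => ‖f s‖ ^ 2 * ((k + l).choose s : ℝ)⁻¹)
    rw [h2, ← hf]
    refine Finset.sum_congr rfl fun s hs => ?_
    have := hchoose (Nat.lt_succ_iff.1 (Finset.mem_range.1 hs))
    field_simp
  have hpure := neg_half_le_re_sum Ψ Vh
  rw [hΨ1, ← hT] at hpure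
  have hid := sum_factorial_mul_norm_sq_le V
  have hdiag : ∑ p : Fin (k + 1) × Fin (l + 1),
        ((p.1 : ℕ)! * (p.2 : ℕ)! * ((k - p.1)! * (l - p.2)!) : ℝ) * ‖V p‖ ^ 2
      = (k ! * l ! : ℝ) * T := by
    rw [Fintype.sum_prod_type, hT, Finset.mul_sum]
    refine Finset.sum_congr rfl fun a _ => ?_
    rw [Finset.mul_sum]
    refine Finset.sum_congr rfl fun b _ => ?_
    simp only [hVh]
    rw [norm_div, Complex.norm_real, div_pow, Real.norm_eq_abs, sq_abs, hr2,
      Nat.cast_choose ℝ (show (a : ℕ) ≤ k by omega), Nat.cast_choose ℝ (show (b : ℕ) ≤ l by omega)]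
    field_simp [hfac]
  set S1 := ∑ p : Fin (k + 1) × Fin (l + 1), ∑ q : Fin (k + 1) × Fin (l + 1), star (V p) * V q *
        ((if (q.1 + p.2 : ℕ) = p.1 + q.2 then
          ((q.1 + p.2 : ℕ)! * (k + l - (q.1 + p.2 : ℕ))! : ℝ) else 0 : ℝ) : ℂ) with hS1
  set S2 := ∑ a, ∑ b, ∑ a', ∑ b', star (Vh a b) * Vh a' b' * (Ψ a' b * star (Ψ a b')) with hS2
  have hsplit : ∑ p, ∑ q, star (V p) * V q *
      dickeKernel (k + l) lam mu f (q.1 + p.2) (p.1 + q.2)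
      = ((lam / (k + l)! : ℝ) : ℂ) * S1 + (mu : ℂ) * S2 := by
    have h2 : S2 = ∑ p : Fin (k + 1) × Fin (l + 1), ∑ q : Fin (k + 1) × Fin (l + 1),
        star (Vh p.1 p.2) * Vh q.1 q.2 * (Ψ q.1 p.2 * star (Ψ p.1 q.2)) := by
      simp only [hS2, Fintype.sum_prod_type]
    rw [h2, hS1]
    simp only [Finset.mul_sum, ← Finset.sum_add_distrib]
    refine Finset.sum_congr rfl fun p _ => Finset.sum_congr rfl fun q _ => ?_
    obtain ⟨a, b⟩ := p
    obtain ⟨a', b'⟩ := q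
    simp only [dickeKernel]
    rw [add_mul, mul_add]
    congr 1
    · by_cases h : (a' + b : ℕ) = a + b'
      · simp only [← h]
        rw [← mul_inv, Real.mul_self_sqrt (by positivity),
          Nat.cast_choose ℝ (show (a' + b : ℕ) ≤ k + l by omega)]
        push_cast
        have := fun n : ℕ => (Nat.cast_ne_zero (R := ℂ)).2 (Nat.factorial_ne_zero n)
        field_simp [this]
      · simp [if_neg h]
    · simp only [hVh, hΨ, hr, star_div₀, star_mul', Complex.star_def, Complex.conj_ofReal]
      have hk : ∀ a : Fin (k + 1), ((√(k.choose a) : ℝ) : ℂ) ≠ 0 := fun a =>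
        Complex.ofReal_ne_zero.2 (Real.sqrt_pos.2 (hchoose (by omega))).ne'
      have hl : ∀ b : Fin (l + 1), ((√(l.choose b) : ℝ) : ℂ) ≠ 0 := fun b =>
        Complex.ofReal_ne_zero.2 (Real.sqrt_pos.2 (hchoose (by omega))).ne'
      have := hk a; have := hk a'; have := hl b; have := hl b'
      push_cast
      field_simp
  rw [hsplit, Complex.add_re, Complex.re_ofReal_mul, Complex.re_ofReal_mul]
  rw [hdiag] at hid
  have hT0 : 0 ≤ T := by positivity
  have h1 : lam / (k + l).choose k * T ≤ lam / (k + l)! * S1.re := by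
    refine le_trans (le_of_eq ?_) (mul_le_mul_of_nonneg_left hid (by positivity))
    rw [Nat.cast_choose ℝ (show k ≤ k + l by omega), Nat.add_sub_cancel_left]
    field_simp [hfac]
  have h2 := mul_le_mul_of_nonneg_left hpure hmu
  have h3 := mul_le_mul_of_nonneg_right hle hT0
  nlinarith

/-! ### From weight coordinates to qubit operators. -/

theorem bitWeight_le {N : ℕ} (x : Fin N → Fin 2) : bitWeight x ≤ N :=
  (Finset.sum_le_card_nsmul _ _ 1 fun i _ => by omega).trans (by simp)

/-- The bit weight as a label of the Dicke basis. -/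
def finWeight {N : ℕ} (x : Fin N → Fin 2) : Fin (N + 1) :=
  ⟨bitWeight x, Nat.lt_succ_iff.2 (bitWeight_le x)⟩

theorem dickeMatrix_apply {N : ℕ} (x : Fin N → Fin 2) (α : Fin (N + 1)) :
    dickeMatrix N x α =
      if finWeight x = α then (((√(N.choose (bitWeight x)))⁻¹ : ℝ) : ℂ) else 0 := by
  simp only [dickeMatrix, Matrix.of_apply, finWeight, Fin.ext_iff]
  split_ifs with h
  · rw [h]
  · rfl

theorem dickeMatrix_mul_mul_apply {N : ℕ} (X : Matrix (Fin (N + 1)) (Fin (N + 1)) ℂ)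
    (x y : Fin N → Fin 2) :
    (dickeMatrix N * X * (dickeMatrix N)ᴴ) x y = X (finWeight x) (finWeight y) *
      (((√(N.choose (bitWeight x)))⁻¹ * (√(N.choose (bitWeight y)))⁻¹ : ℝ) : ℂ) := by
  simp only [Matrix.mul_apply, Matrix.conjTranspose_apply, dickeMatrix_apply, apply_ite star,
    Complex.star_def, Complex.conj_ofReal, star_zero, ite_mul, zero_mul, mul_ite, mul_zero,
    Finset.sum_ite_eq, Finset.mem_univ, if_true]
  push_cast
  ring

theorem card_filter_bitWeight (N s : ℕ) :
    (Finset.univ.filter fun x : Fin N → Fin 2 => bitWeight x = s).card = N.choose s := by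
  have hw : ∀ x : Fin N → Fin 2, bitWeight x = (Finset.univ.filter fun i => x i = 1).card := by
    intro x
    rw [bitWeight, Finset.card_filter]
    refine Finset.sum_congr rfl fun i _ => ?_
    generalize x i = z
    fin_cases z <;> simp
  rw [← Finset.card_fin N, ← Finset.card_powersetCard, Finset.card_fin]
  refine Finset.card_nbij' (fun x => Finset.univ.filter fun i => x i = 1)
    (fun S i => if i ∈ S then 1 else 0) ?_ ?_ ?_ ?_
  · intro x hx
    simpa [Finset.mem_powersetCard, hw] using hx
  · intro S hS
    simpa [Finset.mem_powersetCard, hw] using hS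
  · intro x _
    funext i
    simp only [Finset.mem_filter, Finset.mem_univ, true_and]
    generalize x i = z
    fin_cases z <;> simp
  · intro S _
    ext i
    simp

theorem dickeMatrix_conjTranspose_mul_self (N : ℕ) :
    (dickeMatrix N)ᴴ * dickeMatrix N = 1 := by
  ext α β
  rw [Matrix.mul_apply, Matrix.one_apply]
  simp only [Matrix.conjTranspose_apply, dickeMatrix, Matrix.of_apply]
  split_ifs with h
  · subst h
    have h1 : ∀ x : Fin N → Fin 2,
        star (if bitWeight x = (α : ℕ) then (((√(N.choose (α : ℕ)))⁻¹ : ℝ) : ℂ) else 0) *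
          (if bitWeight x = (α : ℕ) then (((√(N.choose (α : ℕ)))⁻¹ : ℝ) : ℂ) else 0)
        = if bitWeight x = (α : ℕ) then ((N.choose (α : ℕ) : ℝ) : ℂ)⁻¹ else 0 := by
      intro x
      split_ifs
      · rw [Complex.star_def, Complex.conj_ofReal, ← Complex.ofReal_mul, ← mul_inv,
          Real.mul_self_sqrt (by positivity), Complex.ofReal_inv]
      · simp
    simp only [h1]
    rw [← Finset.sum_filter, Finset.sum_const, card_filter_bitWeight, nsmul_eq_mul]
    have : (N.choose (α : ℕ) : ℂ) ≠ 0 :=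
      Nat.cast_ne_zero.2 (Nat.choose_pos (Nat.lt_succ_iff.1 α.2)).ne'
    simp [this]
  · refine Finset.sum_eq_zero fun x _ => ?_
    split_ifs with h1 h2
    · exact absurd (Fin.ext (h1.symm.trans h2)) h
    all_goals simp

/-- The weight of a bit string on a set of qubits. -/
def weightOn {N : ℕ} (A : Finset (Fin N)) (x : Fin N → Fin 2) : ℕ := ∑ i ∈ A, (x i : ℕ)

theorem weightOn_le {N : ℕ} (A : Finset (Fin N)) (x : Fin N → Fin 2) : weightOn A x ≤ A.card :=
  (Finset.sum_le_card_nsmul _ _ 1 fun i _ => by omega).trans (by simp)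

theorem bitWeight_piecewise {N : ℕ} (A : Finset (Fin N)) (x y : Fin N → Fin 2) :
    bitWeight (A.piecewise x y) = weightOn A x + weightOn Aᶜ y := by
  rw [bitWeight, ← Finset.sum_add_sum_compl A, weightOn, weightOn]
  congr 1
  · exact Finset.sum_congr rfl fun i hi => by rw [Finset.piecewise_eq_of_mem _ _ _ hi]
  · exact Finset.sum_congr rfl fun i hi => by
      rw [Finset.piecewise_eq_of_notMem _ _ _ (Finset.mem_compl.1 hi)]

/-- Collapses a form on bit strings to one on pairs of weights, since the entries depend on a string
only through its weights on `A` and `Aᶜ`. -/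
theorem sum_comp_fiberwise {ι κ : Type*} [Fintype ι] [Fintype κ] [DecidableEq κ] (φ : ι → κ)
    (v : ι → ℂ) (K : κ → κ → ℂ) :
    ∑ x, ∑ y, star (v x) * v y * K (φ x) (φ y) =
      ∑ p, ∑ q, star (∑ x with φ x = p, v x) * (∑ y with φ y = q, v y) * K p q := by
  have h : ∀ g : ι → κ → ℂ, ∑ x, g x (φ x) = ∑ p, ∑ x with φ x = p, g x p := by
    intro g
    rw [← Finset.sum_fiberwise _ φ]
    refine Finset.sum_congr rfl fun p _ => Finset.sum_congr rfl fun x hx => ?_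
    rw [(Finset.mem_filter.1 hx).2]
  rw [h fun x p => ∑ y, star (v x) * v y * K p (φ y)]
  refine Finset.sum_congr rfl fun p _ => ?_
  have h' : ∀ x, ∑ y, star (v x) * v y * K p (φ y)
      = ∑ q, ∑ y with φ y = q, star (v x) * v y * K p q := fun x =>
    h fun y q => star (v x) * v y * K p q
  simp only [h']
  rw [Finset.sum_comm]
  refine Finset.sum_congr rfl fun q _ => ?_
  rw [star_sum, Finset.sum_mul_sum, Finset.sum_mul]
  exact Finset.sum_congr rfl fun x _ => by rw [Finset.sum_mul]

theorem partialTranspose_isHermitian {N : ℕ} (A : Finset (Fin N)) {M : QubitOp N}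
    (hM : M.IsHermitian) : (partialTranspose A M).IsHermitian :=
  Matrix.IsHermitian.ext fun _ _ => hM.apply _ _

theorem partialTranspose_posSemidef_of_le {N : ℕ} (A : Finset (Fin N)) {lam mu : ℝ}
    (hlam : 0 ≤ lam) (hmu : 0 ≤ mu) (f : Fin (N + 1) → ℂ) (hf : ∑ s, ‖f s‖ ^ 2 = 1)
    (hle : mu / 2 ≤ lam / N.choose A.card) :
    (partialTranspose A (dickeMatrix N *
      ((lam : ℂ) • 1 + (mu : ℂ) • Matrix.vecMulVec f (star f)) * (dickeMatrix N)ᴴ)).PosSemidef := by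
  set X : Matrix (Fin (N + 1)) (Fin (N + 1)) ℂ :=
    (lam : ℂ) • 1 + (mu : ℂ) • Matrix.vecMulVec f (star f) with hX
  have hXh : X.IsHermitian := by
    ext i j
    simp [hX, Matrix.vecMulVec_apply, Matrix.one_apply, apply_ite, eq_comm, mul_comm]
  have hherm := partialTranspose_isHermitian A (Matrix.isHermitian_mul_mul_conjTranspose (dickeMatrix N) hXh)
  refine Matrix.PosSemidef.of_dotProduct_mulVec_nonneg hherm fun v => ?_
  rw [Complex.nonneg_iff]
  refine ⟨?_, (hherm.im_star_dotProduct_mulVec_self v).symm⟩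
  set F : ℕ → ℂ := fun s => if h : s < N + 1 then f ⟨s, h⟩ else 0 with hF
  have hentry : ∀ x y, (partialTranspose A (dickeMatrix N * X * (dickeMatrix N)ᴴ)) x y
      = dickeKernel N lam mu F (weightOn A y + weightOn Aᶜ x) (weightOn A x + weightOn Aᶜ y) := by
    intro x y
    rw [partialTranspose, Matrix.of_apply, dickeMatrix_mul_mul_apply, dickeKernel]
    have hFw : ∀ z : Fin N → Fin 2, f (finWeight z) = F (bitWeight z) := fun z => by
      simp only [hF, finWeight]
      rw [dif_pos]
    have hXw : ∀ z z' : Fin N → Fin 2, X (finWeight z) (finWeight z')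
        = (if bitWeight z = bitWeight z' then (lam : ℂ) else 0)
          + mu * (F (bitWeight z) * star (F (bitWeight z'))) := fun z z' => by
      simp only [hX, Matrix.add_apply, Matrix.smul_apply, Matrix.one_apply, Matrix.vecMulVec_apply,
        Pi.star_apply, hFw, smul_eq_mul, mul_ite, mul_one, mul_zero]
      simp only [finWeight, Fin.mk.injEq]
    rw [hXw, bitWeight_piecewise, bitWeight_piecewise]
  have hcard : N = A.card + Aᶜ.card := by rw [Finset.card_add_card_compl, Fintype.card_fin]
  set φ : (Fin N → Fin 2) → Fin (A.card + 1) × Fin (Aᶜ.card + 1) := fun x =>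
    (⟨weightOn A x, Nat.lt_succ_iff.2 (weightOn_le A x)⟩,
      ⟨weightOn Aᶜ x, Nat.lt_succ_iff.2 (weightOn_le Aᶜ x)⟩) with hφ
  have hquad : star v ⬝ᵥ (partialTranspose A (dickeMatrix N * X * (dickeMatrix N)ᴴ)) *ᵥ v
      = ∑ x, ∑ y, star (v x) * v y *
        (fun p q : Fin (A.card + 1) × Fin (Aᶜ.card + 1) =>
          dickeKernel N lam mu F (q.1 + p.2) (p.1 + q.2)) (φ x) (φ y) := by
    simp only [dotProduct, Matrix.mulVec, Finset.mul_sum, hentry, hφ, Pi.star_apply]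
    exact Finset.sum_congr rfl fun x _ => Finset.sum_congr rfl fun y _ => by ring
  rw [hquad, sum_comp_fiberwise φ v fun p q : Fin (A.card + 1) × Fin (Aᶜ.card + 1) =>
    dickeKernel N lam mu F (q.1 + p.2) (p.1 + q.2)]
  have hfF : ∑ s ∈ Finset.range (N + 1), ‖F s‖ ^ 2 = 1 := by
    rw [Finset.sum_range, ← hf]
    exact Finset.sum_congr rfl fun s _ => by simp only [hF, dif_pos s.2]
  have key := fun V => dickeKernel_quadForm_nonneg (k := A.card) (l := Aᶜ.card) hlam hmu F
    (by rw [← hcard]; exact hfF) (by rw [← hcard]; exact hle) V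
  rw [← hcard] at key
  exact key _

/-! ### Necessity: the GHZ witness. -/

/-- The GHZ vector in the Dicke basis. -/
noncomputable def ghz (N : ℕ) : Fin (N + 1) → ℂ :=
  fun s => if s = 0 ∨ s = Fin.last N then ((√2)⁻¹ : ℝ) else 0

theorem sum_norm_sq_ghz {N : ℕ} (hN : 1 ≤ N) : ∑ s, ‖ghz N s‖ ^ 2 = 1 := by
  have h : ∀ s, ‖ghz N s‖ ^ 2 = if s = 0 ∨ s = Fin.last N then (1 / 2 : ℝ) else 0 := by
    intro s
    unfold ghz
    split_ifs
    · rw [Complex.norm_real, Real.norm_eq_abs, sq_abs, inv_pow, Real.sq_sqrt (by norm_num)]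
      norm_num
    · simp
  simp only [h]
  rw [← Finset.sum_filter, Finset.sum_const, Finset.filter_or, Finset.filter_eq', Finset.filter_eq']
  have h0 : (0 : Fin (N + 1)) ≠ Fin.last N := by
    rw [Ne, Fin.ext_iff]; simp; omega
  simp [h0]

/-- Partial transposition moves the GHZ coherence between `0…0` and `1…1` to the strings `x`, `y`,
which are constant and opposite on `A` and `Aᶜ`. Their diagonal entries come from the `lam` term
alone, so the vector `x - y` gives the inequality. -/
theorem half_le_of_partialTranspose_posSemidef {N : ℕ} (A : Finset (Fin N)) (hA : A.Nonempty)
    (hA' : Aᶜ.Nonempty) {lam mu : ℝ}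
    (h : (partialTranspose A (dickeMatrix N *
      ((lam : ℂ) • 1 + (mu : ℂ) • Matrix.vecMulVec (ghz N) (star (ghz N))) *
        (dickeMatrix N)ᴴ)).PosSemidef) :
    mu / 2 ≤ lam / N.choose A.card := by
  have hcard : A.card + Aᶜ.card = N := by rw [Finset.card_add_card_compl, Fintype.card_fin]
  have hA0 : 0 < A.card := Finset.card_pos.2 hA
  have hA1 : 0 < Aᶜ.card := Finset.card_pos.2 hA'
  set M := partialTranspose A (dickeMatrix N *
      ((lam : ℂ) • 1 + (mu : ℂ) • Matrix.vecMulVec (ghz N) (star (ghz N))) *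
        (dickeMatrix N)ᴴ) with hM
  set x : Fin N → Fin 2 := A.piecewise 0 1 with hx
  set y : Fin N → Fin 2 := A.piecewise 1 0 with hy
  have w1 : ∀ B : Finset (Fin N), weightOn B 1 = B.card := fun B => by simp [weightOn]
  have w0 : ∀ B : Finset (Fin N), weightOn B 0 = 0 := fun B => by simp [weightOn]
  have e1 : bitWeight x = Aᶜ.card := by rw [hx, bitWeight_piecewise, w1, w0, zero_add]
  have e2 : bitWeight y = A.card := by rw [hy, bitWeight_piecewise, w1, w0, add_zero]
  have e3 : A.piecewise y x = 1 := by
    funext i; by_cases hi : i ∈ A <;> simp [hx, hy, hi]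
  have e4 : A.piecewise x y = 0 := by
    funext i; by_cases hi : i ∈ A <;> simp [hx, hy, hi]
  have b1 : bitWeight (1 : Fin N → Fin 2) = N := by simp [bitWeight]
  have b0 : bitWeight (0 : Fin N → Fin 2) = 0 := by simp [bitWeight]
  have f1 : finWeight (1 : Fin N → Fin 2) = Fin.last N := Fin.ext b1
  have f0 : finWeight (0 : Fin N → Fin 2) = 0 := Fin.ext b0
  have hdiag : ∀ z : Fin N → Fin 2, 0 < bitWeight z → bitWeight z < N →
      M z z = ((lam / N.choose (bitWeight z) : ℝ) : ℂ) := by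
    intro z h0 h1
    rw [hM, partialTranspose, Matrix.of_apply, Finset.piecewise_same, dickeMatrix_mul_mul_apply]
    have hg : ghz N (finWeight z) = 0 := by
      rw [ghz, if_neg]
      simp only [finWeight, Fin.ext_iff, Fin.val_zero, Fin.val_last]
      omega
    rw [← mul_inv, Real.mul_self_sqrt (by positivity)]
    simp [Matrix.vecMulVec_apply, hg, div_eq_mul_inv]
  have hne : Fin.last N ≠ 0 := by rw [Ne, Fin.ext_iff]; simp; omega
  have hoff : ∀ s t : Fin (N + 1), s ≠ t → (s = 0 ∨ s = Fin.last N) → (t = 0 ∨ t = Fin.last N) →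
      ((lam : ℂ) • 1 + (mu : ℂ) • Matrix.vecMulVec (ghz N) (star (ghz N)) :
        Matrix (Fin (N + 1)) (Fin (N + 1)) ℂ) s t = ((mu / 2 : ℝ) : ℂ) := by
    intro s t hst hs ht
    simp only [Matrix.add_apply, Matrix.smul_apply, Matrix.one_apply_ne hst,
      Matrix.vecMulVec_apply, Pi.star_apply, ghz, if_pos hs, if_pos ht, Complex.star_def,
      Complex.conj_ofReal, smul_eq_mul, mul_zero, zero_add]
    rw [← Complex.ofReal_mul, ← mul_inv, Real.mul_self_sqrt (by norm_num), ← Complex.ofReal_mul,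
      div_eq_mul_inv]
  have hxy : M x y = ((mu / 2 : ℝ) : ℂ) := by
    rw [hM, partialTranspose, Matrix.of_apply, dickeMatrix_mul_mul_apply, e3, e4, f1, f0, b1, b0,
      hoff _ _ hne (.inr rfl) (.inl rfl)]
    simp
  have hyx : M y x = ((mu / 2 : ℝ) : ℂ) := by
    rw [hM, partialTranspose, Matrix.of_apply, dickeMatrix_mul_mul_apply, e3, e4, f1, f0, b1, b0,
      hoff _ _ hne.symm (.inl rfl) (.inr rfl)]
    simp
  have hxx := hdiag x (by omega) (by omega)
  have hyy := hdiag y (by omega) (by omega)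
  have hq := (h.submatrix ![x, y]).dotProduct_mulVec_nonneg ![1, -1]
  have hsymm : N.choose Aᶜ.card = N.choose A.card :=
    Nat.choose_symm_of_eq_add (by omega)
  simp [Matrix.mulVec, dotProduct, Fin.sum_univ_two, hxx, hyy, hxy, hyx, e1, e2, hsymm] at hq
  have hq' : (0 : ℂ) ≤ ((2 * (lam / N.choose A.card) - mu : ℝ) : ℂ) :=
    hq.trans_eq (by push_cast; ring)
  rw [Complex.zero_le_real] at hq'
  linarith

/-! ### Symmetric states in the Dicke basis. -/

theorem exists_perm_comp_eq {N : ℕ} {x x' : Fin N → Fin 2} (h : bitWeight x = bitWeight x') :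
    ∃ σ : Equiv.Perm (Fin N), x' ∘ σ = x := by
  have hw : ∀ x : Fin N → Fin 2, bitWeight x = Fintype.card {i // x i = 1} := by
    intro x
    rw [Fintype.card_subtype, bitWeight, Finset.card_filter]
    refine Finset.sum_congr rfl fun i _ => ?_
    generalize x i = z
    fin_cases z <;> simp
  rw [hw, hw] at h
  obtain ⟨e⟩ := Fintype.card_eq.1 h
  refine ⟨e.extendSubtype, funext fun i => ?_⟩
  have h2 : ∀ z : Fin 2, z ≠ 1 → z = 0 := by decide
  by_cases hi : x i = 1
  · exact (e.extendSubtype_mem i hi).trans hi.symm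
  · exact (h2 _ (e.extendSubtype_not_mem i hi)).trans (h2 _ hi).symm

theorem IsSymmetricState.apply_comp {N : ℕ} {ρ : QubitOp N} (hρ : IsSymmetricState ρ)
    (σ τ : Equiv.Perm (Fin N)) (x y : Fin N → Fin 2) : ρ (x ∘ σ) (y ∘ τ) = ρ x y := by
  -- Left multiplication relabels rows by the permutation, right multiplication relabels columns by
  -- its inverse; hence `σ⁻¹` beside `τ`.
  have h := congrFun (congrFun (hρ.perm_invariant σ⁻¹ τ) x) y
  rw [← h, qubitPerm, qubitPerm, Equiv.Perm.permMatrix, Equiv.Perm.permMatrix,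
    PEquiv.toMatrix_toPEquiv_mul, PEquiv.mul_toMatrix_toPEquiv]
  rfl

theorem IsSymmetricState.apply_eq {N : ℕ} {ρ : QubitOp N} (hρ : IsSymmetricState ρ)
    {x x' y y' : Fin N → Fin 2} (hx : bitWeight x = bitWeight x')
    (hy : bitWeight y = bitWeight y') : ρ x y = ρ x' y' := by
  obtain ⟨σ, rfl⟩ := exists_perm_comp_eq hx
  obtain ⟨τ, rfl⟩ := exists_perm_comp_eq hy
  exact hρ.apply_comp σ τ x' y'

theorem exists_bitWeight_eq {N : ℕ} (α : Fin (N + 1)) :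
    ∃ x : Fin N → Fin 2, bitWeight x = α := by
  have h : 0 < (Finset.univ.filter fun x : Fin N → Fin 2 => bitWeight x = α).card := by
    rw [card_filter_bitWeight]
    exact Nat.choose_pos (Nat.lt_succ_iff.1 α.2)
  obtain ⟨x, hx⟩ := Finset.card_pos.1 h
  exact ⟨x, (Finset.mem_filter.1 hx).2⟩

theorem IsSymmetricState.eq_dickeMatrix_mul {N : ℕ} {ρ : QubitOp N} (hρ : IsSymmetricState ρ) :
    ρ = dickeMatrix N * symCompress ρ * (dickeMatrix N)ᴴ := by
  choose rep hrep using @exists_bitWeight_eq N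
  set X : Matrix (Fin (N + 1)) (Fin (N + 1)) ℂ := Matrix.of fun α β =>
    ρ (rep α) (rep β) * ((√(N.choose α) * √(N.choose β) : ℝ) : ℂ) with hX
  have h : ρ = dickeMatrix N * X * (dickeMatrix N)ᴴ := by
    ext x y
    rw [dickeMatrix_mul_mul_apply, hX, Matrix.of_apply,
      hρ.apply_eq (hrep (finWeight x)) (hrep (finWeight y)), mul_assoc, ← Complex.ofReal_mul]
    have hpos : ∀ z : Fin N → Fin 2, √(N.choose (bitWeight z)) ≠ 0 := fun z =>
      (Real.sqrt_pos.2 (Nat.cast_pos.2 (Nat.choose_pos (bitWeight_le z)))).ne'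
    have hx := hpos x
    have hy := hpos y
    have : √(N.choose (finWeight x : ℕ)) * √(N.choose (finWeight y : ℕ)) *
        ((√(N.choose (bitWeight x)))⁻¹ * (√(N.choose (bitWeight y)))⁻¹) = 1 := by
      simp only [finWeight]
      field_simp
    rw [this, Complex.ofReal_one, mul_one]
  have h2 : symCompress ρ = X := by
    calc symCompress ρ = ((dickeMatrix N)ᴴ * dickeMatrix N) * X *
          ((dickeMatrix N)ᴴ * dickeMatrix N) := by
          rw [symCompress]; conv_lhs => rw [h]
          simp only [Matrix.mul_assoc]
      _ = X := by rw [dickeMatrix_conjTranspose_mul_self, one_mul, mul_one]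
  rw [h2]
  exact h

theorem symLift_mul_mul_symLift {N : ℕ} (U R : Matrix (Fin (N + 1)) (Fin (N + 1)) ℂ) :
    symLift U * (dickeMatrix N * R * (dickeMatrix N)ᴴ) * (symLift U)ᴴ
      = dickeMatrix N * (U * R * Uᴴ) * (dickeMatrix N)ᴴ := by
  calc _ = dickeMatrix N * U * ((dickeMatrix N)ᴴ * dickeMatrix N) * R *
        ((dickeMatrix N)ᴴ * dickeMatrix N) * Uᴴ * (dickeMatrix N)ᴴ := by
        simp only [symLift, Matrix.conjTranspose_mul, Matrix.conjTranspose_conjTranspose,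
          Matrix.mul_assoc]
    _ = _ := by
        rw [dickeMatrix_conjTranspose_mul_self]
        simp only [Matrix.mul_assoc, Matrix.one_mul]

/-! ### Spectrum and unitary orbit. -/

theorem mem_unitaryGroup_sum_norm_sq_mulVec {n : Type*} [Fintype n] [DecidableEq n]
    {U : Matrix n n ℂ} (hU : U ∈ Matrix.unitaryGroup n ℂ) (v : n → ℂ) :
    ∑ s, ‖(U *ᵥ v) s‖ ^ 2 = ∑ s, ‖v s‖ ^ 2 := by
  have h : ∀ w : n → ℂ, ((∑ s, ‖w s‖ ^ 2 : ℝ) : ℂ) = star w ⬝ᵥ w := by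
    intro w
    push_cast
    exact Finset.sum_congr rfl fun s _ => (Complex.conj_mul' _).symm
  apply Complex.ofReal_injective
  rw [h, h, Matrix.star_mulVec, ← Matrix.dotProduct_mulVec, Matrix.mulVec_mulVec,
    ← Matrix.star_eq_conjTranspose, Matrix.mem_unitaryGroup_iff'.1 hU, Matrix.one_mulVec]

/-- A Hermitian matrix with all eigenvalues but one equal. -/
theorem Matrix.IsHermitian.exists_eq_smul_one_add_vecMulVec {n : Type*} [Fintype n]
    [DecidableEq n] {R : Matrix n n ℂ} (hR : R.IsHermitian) {a b : ℝ} {m : ℕ}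
    (h : R.charpoly.roots = (a : ℂ) ::ₘ Multiset.replicate m (b : ℂ)) :
    ∃ e : n → ℂ, ∑ s, ‖e s‖ ^ 2 = 1 ∧
      R = (b : ℂ) • 1 + ((a - b : ℝ) : ℂ) • Matrix.vecMulVec e (star e) := by
  rw [hR.roots_charpoly_eq_eigenvalues] at h
  have ha : (a : ℂ) ∈ Multiset.map (RCLike.ofReal ∘ hR.eigenvalues) Finset.univ.val := by
    rw [h]; exact Multiset.mem_cons_self _ _
  obtain ⟨i₀, -, hi₀⟩ := Multiset.mem_map.1 ha
  have hrest : ∀ i, i ≠ i₀ → (RCLike.ofReal ∘ hR.eigenvalues) i = (b : ℂ) := by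
    intro i hi
    rw [← Multiset.cons_erase (Finset.mem_univ_val i₀), Multiset.map_cons, hi₀,
      Multiset.cons_inj_right] at h
    refine Multiset.eq_of_mem_replicate (n := m) ?_
    rw [← h]
    exact Multiset.mem_map_of_mem _ ((Multiset.mem_erase_of_ne hi).2 (Finset.mem_univ_val i))
  set Q : Matrix n n ℂ := hR.eigenvectorUnitary.1 with hQ
  have hQu : Q ∈ Matrix.unitaryGroup n ℂ := hR.eigenvectorUnitary.2
  have hdiag : Matrix.diagonal (RCLike.ofReal ∘ hR.eigenvalues)
      = (b : ℂ) • 1 + ((a - b : ℝ) : ℂ) •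
        Matrix.vecMulVec (Pi.single i₀ 1) (star (Pi.single i₀ (1 : ℂ))) := by
    ext i j
    by_cases hij : i = j
    · subst hij
      by_cases hi : i = i₀
      · subst hi
        rw [Matrix.diagonal_apply_eq, hi₀]
        simp [Matrix.vecMulVec_apply]
      · rw [Matrix.diagonal_apply_eq, hrest i hi]
        simp [Matrix.vecMulVec_apply, hi]
    · rw [Matrix.diagonal_apply_ne _ hij]
      by_cases hi : i = i₀
      · subst hi
        simp [Matrix.vecMulVec_apply, hij, Ne.symm hij]
      · simp [Matrix.vecMulVec_apply, hij, hi]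
  refine ⟨Q *ᵥ Pi.single i₀ 1, ?_, ?_⟩
  · rw [mem_unitaryGroup_sum_norm_sq_mulVec hQu, Finset.sum_eq_single i₀]
    · simp
    · intro j _ hj
      simp [hj]
    · simp
  · conv_lhs => rw [hR.spectral_theorem]
    rw [Unitary.conjStarAlgAut_apply, hdiag, ← hQ, mul_add, add_mul, Matrix.mul_smul,
      Matrix.smul_mul, mul_one, Matrix.mem_unitaryGroup_iff.1 hQu, Matrix.mul_smul,
      Matrix.smul_mul, Matrix.mul_vecMulVec, Matrix.vecMulVec_mul, Matrix.star_mulVec,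
      Matrix.star_eq_conjTranspose]

theorem unitary_conj_smul_one_add_vecMulVec {n : Type*} [Fintype n] [DecidableEq n]
    {U : Matrix n n ℂ} (hU : U ∈ Matrix.unitaryGroup n ℂ) (b c : ℂ) (e : n → ℂ) :
    U * (b • 1 + c • Matrix.vecMulVec e (star e)) * Uᴴ
      = b • 1 + c • Matrix.vecMulVec (U *ᵥ e) (star (U *ᵥ e)) := by
  rw [mul_add, add_mul, Matrix.mul_smul, Matrix.smul_mul, mul_one, ← Matrix.star_eq_conjTranspose,
    Matrix.mem_unitaryGroup_iff.1 hU, Matrix.mul_smul, Matrix.smul_mul, Matrix.mul_vecMulVec,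
    Matrix.vecMulVec_mul, Matrix.star_mulVec, Matrix.star_eq_conjTranspose]

theorem exists_unitary_mulVec_single_eq {n : Type*} [Fintype n] [DecidableEq n] (i : n)
    (g : n → ℂ) (hg : ∑ s, ‖g s‖ ^ 2 = 1) :
    ∃ Q ∈ Matrix.unitaryGroup n ℂ, Q *ᵥ Pi.single i 1 = g := by
  have hon : Orthonormal ℂ (({i} : Set n).domRestrict fun _ => WithLp.toLp 2 g) := by
    refine ⟨fun _ => ?_, fun j k hjk => absurd (Subsingleton.elim j k) hjk⟩
    simp [EuclideanSpace.norm_eq, Set.domRestrict, hg]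
  obtain ⟨b, hb⟩ := hon.exists_orthonormalBasis_extension_of_card_eq (ι := n)
    finrank_euclideanSpace
  refine ⟨_, (EuclideanSpace.basisFun n ℂ).toMatrix_orthonormalBasis_mem_unitary b, ?_⟩
  ext s
  rw [Matrix.mulVec_single_one]
  simp [Module.Basis.toMatrix_apply, hb i rfl]

/-- The special unitary group acts transitively on unit vectors, up to phases. -/
theorem exists_specialUnitary_vecMulVec_eq {n : Type*} [Fintype n] [DecidableEq n] [Nonempty n]
    (e g : n → ℂ) (he : ∑ s, ‖e s‖ ^ 2 = 1) (hg : ∑ s, ‖g s‖ ^ 2 = 1) :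
    ∃ U ∈ Matrix.specialUnitaryGroup n ℂ,
      Matrix.vecMulVec (U *ᵥ e) (star (U *ᵥ e)) = Matrix.vecMulVec g (star g) := by
  obtain ⟨i⟩ := ‹Nonempty n›
  obtain ⟨P, hP, hPe⟩ := exists_unitary_mulVec_single_eq i e he
  obtain ⟨Q, hQ, hQg⟩ := exists_unitary_mulVec_single_eq i g hg
  have hW : Q * star P ∈ Matrix.unitaryGroup n ℂ := mul_mem hQ (Unitary.star_mem hP)
  have hWe : (Q * star P) *ᵥ e = g := by
    rw [← hPe, Matrix.mulVec_mulVec, Matrix.mul_assoc, Matrix.mem_unitaryGroup_iff'.1 hP, mul_one,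
      hQg]
  set W := Q * star P
  have hd : star W.det * W.det = 1 := (Matrix.det_of_mem_unitary hW).1
  have hcard : 0 < Fintype.card n := Fintype.card_pos_iff.2 ⟨i⟩
  -- A scalar `z` with `z ^ n = conj (det W)` normalizes the determinant; its phase cancels in the
  -- rank-one projector.
  obtain ⟨z, hz⟩ := IsAlgClosed.exists_pow_nat_eq (star W.det) hcard
  have hz1 : ‖z‖ = 1 := by
    have h1 : ‖z‖ ^ Fintype.card n = 1 := by
      have h2 : ‖W.det‖ * ‖W.det‖ = 1 := by simpa using congrArg norm hd
      rw [← norm_pow, hz, norm_star]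
      nlinarith [norm_nonneg W.det]
    exact (pow_eq_one_iff_of_nonneg (norm_nonneg z) hcard.ne').1 h1
  have hzz : z * star z = 1 := by
    rw [Complex.star_def, Complex.mul_conj', hz1]; simp
  refine ⟨z • W, Matrix.mem_specialUnitaryGroup_iff.2 ⟨?_, ?_⟩, ?_⟩
  · rw [Matrix.mem_unitaryGroup_iff, star_smul, smul_mul_smul_comm, hzz,
      Matrix.mem_unitaryGroup_iff.1 hW, one_smul]
  · rw [Matrix.det_smul, hz, hd]
  · rw [Matrix.smul_mulVec, hWe]
    ext s t
    simp only [Matrix.vecMulVec_apply, Pi.smul_apply, Pi.star_apply, smul_eq_mul, star_mul']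
    linear_combination (g s * star (g t)) * hzz

/-! ### Threshold and conclusion. -/

theorem pMin_le_iff (N : ℕ) (p : ℝ) :
    pMin N ≤ p ↔ (1 - p) / 2 ≤ p / (N + 1) / N.choose (N / 2) := by
  have hC : (0 : ℝ) < N.choose (N / 2) := Nat.cast_pos.2 (Nat.choose_pos (Nat.div_le_self N 2))
  have hK : (0 : ℝ) < (N + 1) * N.choose (N / 2) := by positivity
  rw [pMin, div_div]
  set K : ℝ := (N + 1) * N.choose (N / 2)
  rw [show (1 : ℝ) / (1 + 2 * K⁻¹) = K / (K + 2) by field_simp, div_le_iff₀ (by positivity),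
    div_le_div_iff₀ two_pos hK]
  constructor <;> intro h <;> linarith

theorem theorem1 (N : ℕ) (hN : 2 ≤ N) (p : ℝ) (hp : p ∈ Set.Icc (0 : ℝ) 1)
    (ρ : QubitOp N) (hρ : IsSymmetricState ρ)
    (hspec : symSpectrum ρ =
      ((1 - (N : ℝ) * p / ((N : ℝ) + 1) : ℝ) : ℂ) ::ₘ
        Multiset.replicate N ((p / ((N : ℝ) + 1) : ℝ) : ℂ)) :
    IsSAPPT ρ ↔ p ∈ Set.Icc (pMin N) 1 := by
  obtain ⟨hp0, hp1⟩ := hp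
  have hR : (symCompress ρ).IsHermitian :=
    Matrix.isHermitian_conjTranspose_mul_mul (dickeMatrix N) hρ.posSemidef.isHermitian
  obtain ⟨e, he, hRe⟩ := hR.exists_eq_smul_one_add_vecMulVec hspec
  have hc : 1 - (N : ℝ) * p / (N + 1) - p / (N + 1) = 1 - p := by field_simp; ring
  rw [hc] at hRe
  have hconj : ∀ U ∈ Matrix.specialUnitaryGroup (Fin (N + 1)) ℂ,
      symLift U * ρ * (symLift U)ᴴ = dickeMatrix N * (((p / (N + 1) : ℝ) : ℂ) • 1 +
        ((1 - p : ℝ) : ℂ) • Matrix.vecMulVec (U *ᵥ e) (star (U *ᵥ e))) * (dickeMatrix N)ᴴ := by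
    intro U hU
    conv_lhs => rw [hρ.eq_dickeMatrix_mul]
    rw [symLift_mul_mul_symLift, hRe, unitary_conj_smul_one_add_vecMulVec hU.1]
  have hlam : 0 ≤ p / ((N : ℝ) + 1) := by positivity
  rw [Set.mem_Icc, pMin_le_iff, and_iff_left hp1]
  constructor
  · intro h
    obtain ⟨U, hU, hUe⟩ :=
      exists_specialUnitary_vecMulVec_eq e (ghz N) he (sum_norm_sq_ghz (by omega))
    -- A balanced cut has the largest binomial coefficient; `2 ≤ N` makes both sides non-empty.
    obtain ⟨A, -, hA⟩ := Finset.exists_subset_card_eq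
      (show N / 2 ≤ (Finset.univ : Finset (Fin N)).card by simp; omega)
    have hA0 : A.Nonempty := Finset.card_pos.1 (by omega)
    have hA1 : Aᶜ.Nonempty := by
      rw [← Finset.card_pos, Finset.card_compl, Fintype.card_fin]; omega
    have h1 := h U hU A hA0 hA1
    rw [hconj U hU, hUe] at h1
    rw [← hA]
    exact half_le_of_partialTranspose_posSemidef A hA0 hA1 h1
  · intro h U hU A _ _
    rw [hconj U hU]
    refine partialTranspose_posSemidef_of_le A hlam (by linarith) _
      ((mem_unitaryGroup_sum_norm_sq_mulVec hU.1 e).trans he) (h.trans ?_)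
    have hpos : 0 < N.choose A.card := Nat.choose_pos (by simpa using A.card_le_univ)
    have hle : N.choose A.card ≤ N.choose (N / 2) := Nat.choose_le_middle _ _
    gcongr
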